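/- Let $Q_n$ be the $n$-cube with vertex set $V_n=\{0,1\}^n\subset\mathbb R^n$, and let $B_n$ be its group of symmetries: the maps $x\mapsto y$ of $\mathbb R^n$ with $y_i=x_{\pi(i)}$ or $y_i=1-x_{\pi(i)}$ for each $i$, where $\pi$ is a permutation of $\{1,\dots,n\}$ and the choice may depend on $i$. For $S\subseteq\mathbb R^n$ put $V_n(S)=V_n\cap S$ and $F(S)=\{w\in B_n: w(S)=S\}$. A $0/1$-polytope is the convex hull of a subset of $V_n$. Let $N_S(k)$ be the number of classes of $0/1$-polytopes with exactly $k$ vertices contained in $S$, where two such polytopes are equivalent if some element of $B_n$ maps one onto the other. For a subgroup $G\le F(S)$ acting on $V_n(S)$, let $$C_{G,S}(u_1,u_2)=\frac1{|G|}\sum_{g\in G}\prod_{i\ge1}(u_1^i+u_2^i)^{c_i(g)},$$ where $c_i(g)$ is the number of $i$-cycles of the permutation of $V_n(S)$ induced by $g$; this is the cycle index of $G$ on $V_n(S)$ with $u_1^i+u_2^i$ substituted for $z_i$. Write $[u_1^pu_2^q]C$ for the coefficient of $u_1^pu_2^q$ in $C$. **Theorem.** Let $2^{n-3}<k\le 2^{n-2}$,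 and let $H$ be a spanned hyperplane of $Q_n$ (a hyperplane of $\mathbb R^n$ spanned by $n$ affinely independent vertices of $Q_n$) with $|V_n(H)|\ge k$. Let $E(H,k)$ be the set of all intersections $H\cap w(H)$ with $w\in B_n$, $w(H)\ne H$ and $|V_n(H\cap w(H))|\ge k$. Let $E_1(H,k)$ be a set of representatives of the equivalence classes of $E(H,k)$ under the symmetries in $F(H)$, and let $E_2(H,k)$ be a set of representatives of the equivalence classes of $E(H,k)$ under the symmetries in $B_n$. For $w\in B_n$ put $q(w)=|V_n(H\cap w(H))|$ and $F(H,w)=\{w'\in F(H): w'(H\cap w(H))=H\cap w(H)\}$. Then $$\begin{aligned}N_H(k)={}&[u_1^ku_2^{|V_n(H)|-k}]\,C_{F(H),H}(u_1,u_2)\\&-\sum_{H\cap w(H)\in E_1(H,k)}[u_1^ku_2^{q(w)-k}]\,C_{F(H,w),\,H\cap w(H)}(u_1,u_2)\\&+\sum_{H\cap w(H)\in E_2(H,k)}[u_1^ku_2^{q(w)-k}]\,C_{F(H\cap w(H)),\,H\cap w(H)}(u_1,u_2).\end{aligned}$$ -/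

import Mathlib

open scoped Pointwise

/-- The vertex set `{0,1}^n` of the hypercube `Q_n`. -/
def cubeVertices (n : ℕ) : Set (Fin n → ℝ) :=
  {x | ∀ i, x i = 0 ∨ x i = 1}

/-- The set of vertices of `Q_n` lying in `S`. -/
def verticesIn {n : ℕ} (S : Set (Fin n → ℝ)) : Set (Fin n → ℝ) :=
  cubeVertices n ∩ S

/-- The group `B_n` of symmetries of `Q_n`: a signed permutation with underlying permutation `π`
and set of minus signs `{i | ε i = true}` acts on `ℝ^n` by sending `x` to `y`, where
`y i = 1 - x (π i)` if `i` carries a minus sign and `y i = x (π i)` otherwise. -/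
def cubeSymm (n : ℕ) : Subgroup (Equiv.Perm (Fin n → ℝ)) where
  carrier := {w | ∃ (π : Equiv.Perm (Fin n)) (ε : Fin n → Bool), ∀ x i,
    w x i = if ε i then 1 - x (π i) else x (π i)}
  one_mem' := ⟨1, fun _ => false, by simp⟩
  mul_mem' := by
    rintro w₁ w₂ ⟨π₁, ε₁, h₁⟩ ⟨π₂, ε₂, h₂⟩
    refine ⟨π₂ * π₁, fun i => xor (ε₁ i) (ε₂ (π₁ i)), fun x i => ?_⟩
    rw [Equiv.Perm.mul_apply, h₁, h₂]
    rcases h1 : ε₁ i <;> rcases h2 : ε₂ (π₁ i) <;> simp [h1, h2]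
  inv_mem' := by
    rintro w ⟨π, ε, h⟩
    refine ⟨π⁻¹, fun i => ε (π⁻¹ i), fun y i => ?_⟩
    obtain ⟨x, rfl⟩ := w.surjective y
    have hx : w⁻¹ (w x) = x := w.symm_apply_apply x
    have hi : π (π⁻¹ i) = i := π.apply_symm_apply i
    rw [hx, h, hi]
    split_ifs <;> simp

theorem smul_mem_cubeVertices {n : ℕ} (w : cubeSymm n) {x : Fin n → ℝ}
    (hx : x ∈ cubeVertices n) : w • x ∈ cubeVertices n := by
  obtain ⟨w, π, ε, h⟩ := w
  intro i
  change w x i = 0 ∨ w x i = 1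
  rw [h]
  cases ε i <;> rcases hx (π i) with h0 | h0 <;> simp [h0]

instance {n : ℕ} : Finite (cubeSymm n) := by
  have key : ∀ w : cubeSymm n, ∃ p : Equiv.Perm (Fin n) × (Fin n → Bool),
      ∀ x i, w.1 x i = if p.2 i then 1 - x (p.1 i) else x (p.1 i) := by
    rintro ⟨w, π, ε, h⟩
    exact ⟨(π, ε), h⟩
  choose f hf using key
  refine Finite.of_injective f fun w₁ w₂ h => ?_
  apply Subtype.ext
  ext x i
  rw [hf w₁, hf w₂, h]

instance {n : ℕ} (S : Set (Fin n → ℝ)) : Finite (verticesIn S) := by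
  refine Finite.of_injective
    (fun (x : verticesIn S) (i : Fin n) => (decide (x.1 i = 0) : Bool)) fun x y h => ?_
  apply Subtype.ext
  funext i
  have h' := congrFun h i
  simp only [decide_eq_decide] at h'
  rcases x.2.1 i with hx | hx <;> rcases y.2.1 i with hy | hy <;> simp_all

/-- A spanned hyperplane of `Q_n`: the affine span of `n` affinely independent vertices. -/
def IsSpannedHyperplane {n : ℕ} (H : Set (Fin n → ℝ)) : Prop :=
  ∃ v : Fin n → (Fin n → ℝ), (∀ i, v i ∈ cubeVertices n) ∧ AffineIndependent ℝ v ∧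
    H = (affineSpan ℝ (Set.range v) : Set (Fin n → ℝ))

/-- A `0/1`-polytope of `Q_n`: the convex hull of a set of vertices of `Q_n`. -/
def IsZeroOnePolytope {n : ℕ} (P : Set (Fin n → ℝ)) : Prop :=
  ∃ T ⊆ cubeVertices n, P = convexHull ℝ T

/-- The `0/1`-polytopes of `Q_n` contained in `S` and having exactly `k` vertices
(extreme points). -/
def PolytopesIn {n : ℕ} (S : Set (Fin n → ℝ)) (k : ℕ) : Type :=
  {P : Set (Fin n → ℝ) // IsZeroOnePolytope P ∧ P ⊆ S ∧ (P.extremePoints ℝ).ncard = k}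

/-- Two `0/1`-polytopes contained in `S` are equivalent if some symmetry of `Q_n` transforms one
into the other. -/
def partialEquivalence {n : ℕ} (S : Set (Fin n → ℝ)) (k : ℕ) : Setoid (PolytopesIn S k) :=
  (MulAction.orbitRel (cubeSymm n) (Set (Fin n → ℝ))).comap Subtype.val

/-- `N_S(k)`: the number of partial `0/1`-equivalence classes of `S` with `k` vertices. -/
noncomputable def numPartialClasses {n : ℕ} (S : Set (Fin n → ℝ)) (k : ℕ) : ℕ :=
  Nat.card (Quotient (partialEquivalence S k))

open Classical in
/-- The cycle index of a finite group `G` acting on a finite set `X`: the average over `g ∈ G` of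
`∏ z_i ^ c_i(g)`, where `c_i(g)` is the number of `i`-cycles (fixed points included, for `i = 1`)
of the permutation of `X` induced by `g`. -/
noncomputable def cycleIndex (G X : Type*) [Group G] [MulAction G X] [Finite G] [Finite X] :
    MvPolynomial ℕ ℚ :=
  letI := Fintype.ofFinite G
  letI := Fintype.ofFinite X
  MvPolynomial.C (1 / (Fintype.card G : ℚ)) *
    ∑ g : G, (((MulAction.toPerm g : Equiv.Perm X).partition.parts).map MvPolynomial.X).prod

/-- A subgroup of the stabilizer of `S` acts on the set of vertices of `Q_n` lying in `S`. -/
@[reducible] def verticesAction {n : ℕ} (S : Set (Fin n → ℝ)) (G : Subgroup (cubeSymm n))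
    (hG : G ≤ MulAction.stabilizer (cubeSymm n) S) : MulAction G (verticesIn S) where
  smul g x := ⟨(g : cubeSymm n) • (x : Fin n → ℝ), smul_mem_cubeVertices _ x.2.1, by
    have h := Set.smul_mem_smul_set (a := (g : cubeSymm n)) x.2.2
    rwa [MulAction.mem_stabilizer_iff.1 (hG g.2)] at h⟩
  one_smul _ := Subtype.ext (one_smul (cubeSymm n) _)
  mul_smul a b _ := Subtype.ext (mul_smul (a : cubeSymm n) (b : cubeSymm n) _)

/-- The polynomial in `u_1, u_2` (the variables `0` and `1`) obtained from the cycle index of `G`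
acting on the vertices of `Q_n` in `S` by substituting `u_1 ^ i + u_2 ^ i` for `z_i`. -/
noncomputable def polyaPolynomial {n : ℕ} (S : Set (Fin n → ℝ)) (G : Subgroup (cubeSymm n))
    (hG : G ≤ MulAction.stabilizer (cubeSymm n) S) : MvPolynomial (Fin 2) ℚ :=
  letI := verticesAction S G hG
  MvPolynomial.aeval (fun i : ℕ => (MvPolynomial.X 0 ^ i + MvPolynomial.X 1 ^ i :
    MvPolynomial (Fin 2) ℚ)) (cycleIndex G (verticesIn S))

/-- The coefficient of `u_1 ^ k * u_2 ^ (q - k)` in the above polynomial, where `q` is the number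
of vertices of `Q_n` in `S`. -/
noncomputable def polyaCoeff {n : ℕ} (S : Set (Fin n → ℝ)) (G : Subgroup (cubeSymm n))
    (hG : G ≤ MulAction.stabilizer (cubeSymm n) S) (k : ℕ) : ℚ :=
  (polyaPolynomial S G hG).coeff
    (Finsupp.single 0 k + Finsupp.single 1 ((verticesIn S).ncard - k))

/-- The intersection `H ∩ w(H)`. -/
def interSymm {n : ℕ} (H : Set (Fin n → ℝ)) (w : cubeSymm n) : Set (Fin n → ℝ) :=
  H ∩ (w • H)

/-- The set `E(H,k)` of the intersections `H ∩ w(H)`, `w ∈ B_n`, with `w(H) ≠ H`, that contain at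
least `k` vertices of `Q_n`. -/
def intersections {n : ℕ} (H : Set (Fin n → ℝ)) (k : ℕ) : Set (Set (Fin n → ℝ)) :=
  {S | ∃ w : cubeSymm n, H ≠ w • H ∧ k ≤ (verticesIn (interSymm H w)).ncard ∧
    S = interSymm H w}

/-- The intersections `H ∩ w(H)`, `w ∈ R`, form a complete set of representatives, without
repetition, of the equivalence classes of `E(H,k)` under the symmetries in `G`. -/
def IsRepresentatives {n : ℕ} (H : Set (Fin n → ℝ)) (k : ℕ) (G : Subgroup (cubeSymm n))
    (R : Finset (cubeSymm n)) : Prop :=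
  (∀ w ∈ R, interSymm H w ∈ intersections H k) ∧
    ∀ S ∈ intersections H k, ∃! w, w ∈ R ∧ ∃ g ∈ G, g • S = interSymm H w

/-- The stabilizer `F(H)` of a set `H` in `B_n`. -/
abbrev stab {n : ℕ} (H : Set (Fin n → ℝ)) : Subgroup (cubeSymm n) :=
  MulAction.stabilizer (cubeSymm n) H

/-- The group `F(H,w)` of the elements of `F(H)` that stabilize `H ∩ w(H)`. -/
abbrev stabInter {n : ℕ} (H : Set (Fin n → ℝ)) (w : cubeSymm n) : Subgroup (cubeSymm n) :=
  stab H ⊓ stab (interSymm H w)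

/-! A set of 0/1 points spanning an affine space of dimension `d` has at most `2 ^ d` points
(`ncard_le_two_pow_finrank`). Hence `k > 2 ^ (n - 3)` vertices span dimension at least `n - 2`,
while `H ∩ w(H)` with `w(H) ≠ H` has dimension at most `n - 2`. So every `k`-set of vertices inside
such an intersection has it as affine span (`affineSpan_eq_interSymm`).

Split the `k`-sets of vertices in `H` into `Y₂`, those whose span lies in `E(H,k)`, and the rest
`Y₁`. No class meets both. If `g` carries one member of `Y₁` to another, then `g(H) = H`, since
otherwise the image lies in `H ∩ g(H)` and belongs to `Y₂`. Thus `B_n` and `F(H)` have equally many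
classes on `Y₁`, and `N_H(k)` is the `F(H)`-count on all `k`-sets, minus the `F(H)`-count on `Y₂`,
plus the `B_n`-count on `Y₂`. The map sending a set to its span breaks each count on `Y₂` into
counts over representative intersections (`numClasses_eq_sum_fibers`), and Burnside's lemma turns
orbit counts into coefficients (`polyaCoeff_eq`). -/

/-! ### Pólya counting of `k`-subsets through the cycle index. -/

section CycleIndex

open Equiv.Perm Finset

/-- Indexing the factors by cycles, as `SameCycle` classes, lets the product of binomials be
expanded over sets of cycles. -/
theorem Equiv.Perm.prod_map_parts_partition {X M : Type*} [Fintype X] [DecidableEq X]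
    [CommMonoid M] (σ : Equiv.Perm X) [Fintype (Quotient (SameCycle.setoid σ))]
    [DecidableEq (Quotient (SameCycle.setoid σ))] (f : ℕ → M) :
    (σ.partition.parts.map f).prod =
      ∏ q : Quotient (SameCycle.setoid σ),
        f #{x | (Quotient.mk (SameCycle.setoid σ) x) = q} := by
  classical
  let mk := Quotient.mk (SameCycle.setoid σ)
  have hmk : ∀ x y, mk x = mk y ↔ SameCycle σ x y := fun x y => Quotient.eq
  have hsupp : ∀ x y, SameCycle σ x y → (x ∈ σ.support ↔ y ∈ σ.support) := by
    intro x y h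
    rw [mem_support, mem_support, ne_eq, ne_eq, not_iff_not]
    exact h.apply_eq_self_iff
  have huniv : (univ : Finset (Quotient (SameCycle.setoid σ))) =
      (σ.support.image mk) ∪ (σ.supportᶜ.image mk) := by
    rw [← image_union, union_compl]
    exact (image_univ_of_surjective Quotient.mk_surjective).symm
  have hdisj : _root_.Disjoint (σ.support.image mk) (σ.supportᶜ.image mk) := by
    rw [disjoint_left]
    intro q hq hq'
    obtain ⟨x, hx, rfl⟩ := mem_image.1 hq
    obtain ⟨y, hy, hxy⟩ := mem_image.1 hq'
    exact (mem_compl.1 hy) ((hsupp y x ((hmk _ _).1 hxy)).2 hx)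
  have hfix : ∀ x ∈ σ.supportᶜ, ∀ y, mk y = mk x ↔ y = x := by
    intro x hx y
    rw [hmk]
    refine ⟨fun h => ?_, fun h => h ▸ SameCycle.refl σ y⟩
    have hx' : σ x = x := by simpa using hx
    obtain ⟨i, hi⟩ := h.symm
    rw [← hi, zpow_apply_eq_self_of_apply_eq_self hx']
  -- Classes in the support match the nontrivial cycle factors; the others are singletons and give
  -- the parts equal to 1.
  rw [huniv, prod_union hdisj, parts_partition, Multiset.map_add, Multiset.prod_add]
  congr 1
  · rw [cycleType_def, Multiset.map_map]
    symm
    let cyc : Quotient (SameCycle.setoid σ) → Equiv.Perm X :=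
      Quotient.lift (fun x => σ.cycleOf x) fun x y h => SameCycle.cycleOf_eq h
    refine prod_nbij cyc ?_ ?_ ?_ ?_
    · intro q hq
      obtain ⟨x, hx, rfl⟩ := mem_image.1 hq
      exact cycleOf_mem_cycleFactorsFinset_iff.2 hx
    · intro q hq q' hq' h
      obtain ⟨x, hx, rfl⟩ := mem_image.1 hq
      obtain ⟨y, hy, rfl⟩ := mem_image.1 hq'
      have h : σ.cycleOf x = σ.cycleOf y := h
      have : y ∈ (σ.cycleOf x).support := by
        rw [h, mem_support_cycleOf_iff]
        exact ⟨SameCycle.refl _ _, hy⟩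
      exact (hmk _ _).2 (mem_support_cycleOf_iff.1 this).1
    · intro c hc
      obtain ⟨x, hx⟩ := (mem_cycleFactorsFinset_iff.1 hc).1.nonempty_support
      exact ⟨mk x, mem_image_of_mem _ (mem_cycleFactorsFinset_support_le hc hx),
        (cycle_is_cycleOf hx hc).symm⟩
    · intro q hq
      obtain ⟨x, hx, rfl⟩ := mem_image.1 hq
      simp only [Function.comp_apply]
      congr 2
      ext y
      rw [mem_filter_univ]
      change mk y = mk x ↔ y ∈ (σ.cycleOf x).support
      rw [hmk, mem_support_cycleOf_iff, sameCycle_comm]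
      exact (and_iff_left hx).symm
  · rw [prod_image, Multiset.map_replicate, Multiset.prod_replicate, ← card_compl,
      prod_congr rfl (g := fun _ => f 1), prod_const]
    · intro x hx
      congr 1
      rw [card_eq_one]
      refine ⟨x, ?_⟩
      ext y
      simpa using hfix x hx y
    · intro x hx y hy h
      exact (hfix y hy x).1 h

theorem Equiv.Perm.image_eq_iff_forall_sameCycle {X : Type*} [Fintype X] [DecidableEq X]
    (σ : Equiv.Perm X) (s : Finset X) :
    s.image σ = s ↔ ∀ x y, SameCycle σ x y → (x ∈ s ↔ y ∈ s) := by
  constructor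
  · intro h
    have h1 : ∀ x, x ∈ s ↔ σ x ∈ s := fun x => by
      conv_rhs => rw [← h, σ.injective.mem_finset_image]
    have h2 : ∀ (m : ℕ) x, x ∈ s ↔ (σ ^ m) x ∈ s := by
      intro m
      induction m with
      | zero => simp
      | succ m ih => intro x; rw [pow_succ', mul_apply, ← h1, ← ih]
    rintro x y ⟨i, rfl⟩
    cases i with
    | ofNat m => exact h2 m x
    | negSucc m =>
      rw [zpow_negSucc, h2 (m + 1) (((σ ^ (m + 1))⁻¹) x), ← mul_apply, mul_inv_cancel, one_apply]
  · intro h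
    ext x
    rw [mem_image]
    constructor
    · rintro ⟨y, hy, rfl⟩
      exact (h y (σ y) ⟨1, by simp⟩).1 hy
    · intro hx
      exact ⟨σ⁻¹ x, (h _ x ⟨1, by simp⟩).2 hx, by simp⟩

/-- Expanding the product chooses a set of cycles to receive `X 0`; the union of the chosen cycles
is an invariant subset, and every invariant subset arises once. -/
theorem Equiv.Perm.coeff_prod_map_parts_partition {X : Type*} [Fintype X] [DecidableEq X]
    (σ : Equiv.Perm X) (k : ℕ) :
    ((σ.partition.parts.map fun i =>
      (MvPolynomial.X 0 ^ i + MvPolynomial.X 1 ^ i : MvPolynomial (Fin 2) ℚ)).prod).coeff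
      (Finsupp.single 0 k + Finsupp.single 1 (Fintype.card X - k)) =
      #{s : Finset X | s.image σ = s ∧ #s = k} := by
  classical
  let mk := Quotient.mk (SameCycle.setoid σ)
  let c : Quotient (SameCycle.setoid σ) → ℕ := fun q => #{x | mk x = q}
  have hc : ∀ t : Finset (Quotient (SameCycle.setoid σ)), ∑ q ∈ t, c q = #{x | mk x ∈ t} := by
    intro t
    rw [card_eq_sum_card_fiberwise (f := mk) (t := t) fun x hx => by simpa using hx]
    refine sum_congr rfl fun q hq => ?_
    rw [filter_filter]
    refine congrArg card (Finset.ext fun x => ?_)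
    simp only [mem_filter_univ]
    exact ⟨fun h => ⟨h ▸ hq, h⟩, fun h => h.2⟩
  rw [prod_map_parts_partition, prod_add, MvPolynomial.coeff_sum]
  have hterm : ∀ t ∈ (univ : Finset (Quotient (SameCycle.setoid σ))).powerset,
      MvPolynomial.coeff (Finsupp.single 0 k + Finsupp.single 1 (Fintype.card X - k))
        ((∏ q ∈ t, (MvPolynomial.X 0 : MvPolynomial (Fin 2) ℚ) ^ c q) *
          ∏ q ∈ univ \ t, (MvPolynomial.X 1 : MvPolynomial (Fin 2) ℚ) ^ c q) =
        if #{x | mk x ∈ t} = k then 1 else 0 := by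
    intro t _
    rw [prod_pow_eq_pow_sum, prod_pow_eq_pow_sum, hc, hc, MvPolynomial.X_pow_eq_monomial,
      MvPolynomial.X_pow_eq_monomial, MvPolynomial.monomial_mul, MvPolynomial.coeff_monomial,
      one_mul]
    have hsum : #{x | mk x ∈ t} + #{x | mk x ∈ univ \ t} = Fintype.card X := by
      simpa using card_filter_add_card_filter_not (s := (univ : Finset X)) (fun x => mk x ∈ t)
    congr 1
    rw [eq_iff_iff]
    -- The exponent of `X 0` decides alone, so the truncated subtraction is harmless: if `k` exceeds
    -- the size of `X`, both sides vanish.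
    constructor
    · intro h
      simpa using DFunLike.congr_fun h 0
    · intro h
      rw [← h, show #{x | mk x ∈ univ \ t} = Fintype.card X - #{x | mk x ∈ t} by omega]
  rw [sum_congr rfl hterm, sum_boole, Nat.cast_inj, powerset_univ]
  refine card_nbij (fun t => ({x | mk x ∈ t} : Finset X)) ?_ ?_ ?_
  · intro t ht
    simp only [coe_filter, mem_univ, true_and, Set.mem_ofPred_eq] at ht ⊢
    refine ⟨?_, ht⟩
    rw [image_eq_iff_forall_sameCycle]
    intro x y hxy
    have : mk x = mk y := Quotient.sound hxy
    simp [this]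
  · intro t _ t' _ h
    ext q
    obtain ⟨x, rfl⟩ := Quotient.mk_surjective q
    simpa using congrArg (x ∈ ·) h
  · intro s hs
    simp only [coe_filter, mem_univ, true_and, Set.mem_ofPred_eq] at hs
    have key : ({x | mk x ∈ s.image mk} : Finset X) = s := by
      ext x
      simp only [mem_filter_univ, mem_image]
      constructor
      · rintro ⟨y, hy, hxy⟩
        exact ((image_eq_iff_forall_sameCycle σ s).1 hs.1 y x (Quotient.exact hxy)).1 hy
      · exact fun hx => ⟨x, hx, rfl⟩
    refine ⟨s.image mk, ?_, key⟩
    simp only [coe_filter, mem_univ, true_and, Set.mem_ofPred_eq]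
    rw [key]
    exact hs.2

theorem coeff_cycleIndex {G X : Type*} [Group G] [MulAction G X] [Finite G] [Finite X]
    [DecidableEq X] (k : ℕ) :
    (MvPolynomial.aeval (fun i : ℕ => (MvPolynomial.X 0 ^ i + MvPolynomial.X 1 ^ i :
      MvPolynomial (Fin 2) ℚ)) (cycleIndex G X)).coeff
      (Finsupp.single 0 k + Finsupp.single 1 (Nat.card X - k)) =
      Nat.card (Quotient (MulAction.orbitRel G (Set.powersetCard X k))) := by
  let _ := Fintype.ofFinite G
  let _ := Fintype.ofFinite X
  classical
  have hfix : ∀ g : G, #{s : Finset X | s.image (MulAction.toPerm g : Equiv.Perm X) = s ∧ #s = k} =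
      Fintype.card (MulAction.fixedBy (Set.powersetCard X k) g) := by
    intro g
    rw [← Fintype.card_coe]
    refine Fintype.card_congr
      { toFun := fun s => ⟨⟨s.1, ?_⟩, ?_⟩
        invFun := fun s => ⟨s.1.1, ?_⟩
        left_inv := fun s => rfl
        right_inv := fun s => rfl }
    · exact (mem_filter_univ _).1 s.2 |>.2
    · apply Subtype.ext
      exact (mem_filter_univ _).1 s.2 |>.1
    · rw [mem_filter_univ]
      exact ⟨congrArg Subtype.val s.2, s.1.2⟩
  have hG : (Fintype.card G : ℚ) ≠ 0 := Nat.cast_ne_zero.2 Fintype.card_ne_zero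
  have burnside := MulAction.sum_card_fixedBy_eq_card_orbits_mul_card_group G
    (Set.powersetCard X k)
  unfold cycleIndex
  rw [map_mul, map_sum]
  simp only [map_multiset_prod, Multiset.map_map, Function.comp_def, MvPolynomial.aeval_X]
  rw [MvPolynomial.aeval_C, MvPolynomial.algebraMap_eq, MvPolynomial.coeff_C_mul,
    MvPolynomial.coeff_sum, Nat.card_eq_fintype_card (α := X)]
  have h2 : ∀ g : G, _ = ((Fintype.card (MulAction.fixedBy (Set.powersetCard X k) g) : ℕ) : ℚ) :=
    fun g => (coeff_prod_map_parts_partition (MulAction.toPerm g : Equiv.Perm X) k).trans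
      (congrArg Nat.cast (hfix g))
  rw [Nat.card_eq_fintype_card]
  have h3 : (∑ g : G, ((Fintype.card (MulAction.fixedBy (Set.powersetCard X k) g) : ℕ) : ℚ)) =
      Fintype.card (Quotient (MulAction.orbitRel G (Set.powersetCard X k))) * Fintype.card G := by
    exact_mod_cast burnside
  rw [one_div, inv_mul_eq_iff_eq_mul₀ hG, mul_comm (Fintype.card G : ℚ), ← h3]
  refine sum_congr rfl fun g _ => ?_
  rw [← h2 g]
  congr!

end CycleIndex

/-! ### Counting the classes of a relation that meet a given set. -/

section NumClasses

/-- The number of classes of `s` that meet `Y`. -/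
noncomputable def numClasses {α : Type*} (s : Setoid α) (Y : Set α) : ℕ :=
  (Quotient.mk s '' Y).ncard

/-- This moves orbit counts on different types into one ambient quotient, where sets that are not
invariant can also be counted. -/
theorem card_quotient_comap {α γ : Type*} (s : Setoid α) (f : γ → α) :
    Nat.card (Quotient (s.comap f)) = numClasses s (Set.range f) := by
  let F : Quotient (s.comap f) → Quotient s :=
    Quotient.lift (fun c => Quotient.mk s (f c)) fun _ _ h => Quotient.sound h
  have hF : Function.Injective F := by
    intro q q'
    induction q using Quotient.inductionOn
    induction q' using Quotient.inductionOn
    intro h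
    exact Quotient.sound (s := s.comap f) ((Quotient.eq (r := s)).1 h)
  have hrange : Set.range F = Quotient.mk s '' Set.range f := by
    ext q
    constructor
    · rintro ⟨q, rfl⟩
      induction q using Quotient.inductionOn with
      | h c => exact ⟨f c, ⟨c, rfl⟩, rfl⟩
    · rintro ⟨_, ⟨c, rfl⟩, rfl⟩
      exact ⟨Quotient.mk _ c, rfl⟩
  rw [numClasses, ← hrange, ← Nat.card_coe_set_eq]
  exact Nat.card_congr (Equiv.ofInjective F hF)

theorem numClasses_image {α β : Type*} (s : Setoid α) (s' : Setoid β) (Y : Set α) (f : α → β)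
    (h : ∀ x ∈ Y, ∀ y ∈ Y, s x y ↔ s' (f x) (f y)) :
    numClasses s' (f '' Y) = numClasses s Y := by
  have h1 := card_quotient_comap s (Subtype.val : Y → α)
  have h2 := card_quotient_comap s' (fun y : Y => f y)
  rw [Subtype.range_coe] at h1
  rw [show Set.range (fun y : Y => f y) = f '' Y by ext; simp] at h2
  rw [← h1, ← h2]
  congr 2
  ext x y
  exact (h x x.2 y y.2).symm

theorem numClasses_congr {α : Type*} (s s' : Setoid α) (Y : Set α)
    (h : ∀ x ∈ Y, ∀ y ∈ Y, s x y ↔ s' x y) : numClasses s' Y = numClasses s Y := by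
  simpa using numClasses_image s s' Y id h

theorem numClasses_union {α : Type*} (s : Setoid α) {Y Z : Set α} (hY : Y.Finite) (hZ : Z.Finite)
    (h : ∀ y ∈ Y, ∀ z ∈ Z, ¬ s y z) : numClasses s (Y ∪ Z) = numClasses s Y + numClasses s Z := by
  rw [numClasses, Set.image_union, Set.ncard_union_eq _ (hY.image _) (hZ.image _)]
  · rfl
  · rw [Set.disjoint_left]
    rintro _ ⟨y, hy, rfl⟩ ⟨z, hz, hzy⟩
    exact h y hy z hz (s.symm (Quotient.exact hzy))

theorem numClasses_biUnion {α ι : Type*} (s : Setoid α) (R : Finset ι) (Y : ι → Set α)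
    (hY : ∀ i ∈ R, (Y i).Finite)
    (h : ∀ i ∈ R, ∀ j ∈ R, i ≠ j → ∀ y ∈ Y i, ∀ z ∈ Y j, ¬ s y z) :
    numClasses s (⋃ i ∈ R, Y i) = ∑ i ∈ R, numClasses s (Y i) := by
  classical
  induction R using Finset.induction_on with
  | empty => simp [numClasses]
  | insert a R ha ih =>
    rw [Finset.set_biUnion_insert, Finset.sum_insert ha, numClasses_union, ih]
    · exact fun i hi => hY i (Finset.mem_insert_of_mem hi)
    · exact fun i hi j hj => h i (Finset.mem_insert_of_mem hi) j (Finset.mem_insert_of_mem hj)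
    · exact hY a (Finset.mem_insert_self a R)
    · exact R.finite_toSet.biUnion fun i hi => hY i (Finset.mem_insert_of_mem hi)
    · intro y hy z hz
      simp only [Set.mem_iUnion] at hz
      obtain ⟨i, hi, hz⟩ := hz
      exact h a (Finset.mem_insert_self a R) i (Finset.mem_insert_of_mem hi)
        (fun hai => ha (hai ▸ hi)) y hy z hz

theorem orbitRel_subgroup_iff {Γ α : Type*} [Group Γ] [MulAction Γ α] (G : Subgroup Γ) (x y : α) :
    MulAction.orbitRel G α x y ↔ ∃ g ∈ G, g • y = x := by
  rw [MulAction.orbitRel_apply, MulAction.mem_orbit_iff]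
  exact ⟨fun ⟨g, hg⟩ => ⟨g, g.2, hg⟩, fun ⟨g, hg, h⟩ => ⟨⟨g, hg⟩, h⟩⟩

/-- Counting orbits along an equivariant map `f`: the orbits of `G` on the preimage of `E` are
counted by the orbits of stabilizers on the fibres over representatives of the orbits on `E`. -/
theorem numClasses_eq_sum_fibers {Γ α β ι : Type*} [Group Γ] [MulAction Γ α] [MulAction Γ β]
    (G : Subgroup Γ) (K : ι → Subgroup Γ) {W : Set α} (hW : W.Finite)
    (hGW : ∀ g ∈ G, ∀ x ∈ W, g • x ∈ W) (f : α → β) (hf : ∀ (g : Γ) x, f (g • x) = g • f x)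
    (E : Set β) (R : Finset ι) (S : ι → β) (hK : ∀ i g, g ∈ K i ↔ g ∈ G ∧ g • S i = S i)
    (hSE : ∀ i ∈ R, S i ∈ E) (hR : ∀ b ∈ E, ∃! i, i ∈ R ∧ ∃ g ∈ G, g • b = S i) :
    numClasses (MulAction.orbitRel G α) {x | x ∈ W ∧ f x ∈ E} =
      ∑ i ∈ R, numClasses (MulAction.orbitRel (K i) α) {x | x ∈ W ∧ f x = S i} := by
  have hfin : ∀ i ∈ R, {x | x ∈ W ∧ f x = S i}.Finite := fun i _ => hW.subset fun x hx => hx.1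
  have hunion : numClasses (MulAction.orbitRel G α) {x | x ∈ W ∧ f x ∈ E} =
      numClasses (MulAction.orbitRel G α) (⋃ i ∈ R, {x | x ∈ W ∧ f x = S i}) := by
    rw [numClasses, numClasses]
    congr 1
    -- The set on the left need not be `G`-invariant; it suffices that each of its points can be
    -- moved within `W` into a fibre over a representative.
    apply subset_antisymm
    · rintro _ ⟨x, ⟨hxW, hxE⟩, rfl⟩
      obtain ⟨i, ⟨hi, g, hg, hgS⟩, -⟩ := hR _ hxE
      refine ⟨g • x, ?_, Quotient.sound ((orbitRel_subgroup_iff _ _ _).2 ⟨g, hg, rfl⟩)⟩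
      simp only [Set.mem_iUnion]
      exact ⟨i, hi, hGW g hg x hxW, by rw [hf, hgS]⟩
    · apply Set.image_mono
      intro x hx
      simp only [Set.mem_iUnion] at hx
      obtain ⟨i, hi, hxW, hxS⟩ := hx
      exact ⟨hxW, hxS ▸ hSE i hi⟩
  rw [hunion, numClasses_biUnion _ _ _ hfin]
  · refine Finset.sum_congr rfl fun i _ => numClasses_congr _ _ _ ?_
    rintro x ⟨_, hx⟩ y ⟨_, hy⟩
    rw [orbitRel_subgroup_iff, orbitRel_subgroup_iff]
    constructor
    · rintro ⟨g, hg, h⟩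
      exact ⟨g, ((hK _ _).1 hg).1, h⟩
    · rintro ⟨g, hg, h⟩
      -- By equivariance, an element joining two points of one fibre fixes the base point.
      refine ⟨g, (hK _ _).2 ⟨hg, ?_⟩, h⟩
      rw [← hy, ← hf, h, hx, hy]
  · rintro i hi j hj hij y ⟨_, hy⟩ z ⟨_, hz⟩ hyz
    obtain ⟨g, hg, h⟩ := (orbitRel_subgroup_iff _ _ _).1 hyz
    refine hij ((hR (S j) (hSE j hj)).unique ⟨hi, g, hg, ?_⟩ ⟨hj, 1, G.one_mem, one_smul _ _⟩)
    rw [← hz, ← hf, h, hy]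

end NumClasses

/-! ### Cube geometry: dimension bounds, hulls and spans of vertex sets. -/

section Cube

/-- A maximal independent family of coordinate functionals on the direction space has at most its
dimension many members. These coordinates determine all others on `A`, and each takes only two
values. -/
theorem ncard_le_two_pow_finrank {n : ℕ} {A : Set (Fin n → ℝ)} (hA : A ⊆ cubeVertices n) :
    A.ncard ≤ 2 ^ Module.finrank ℝ (vectorSpan ℝ A) := by
  classical
  let φ : Fin n → Module.Dual ℝ (vectorSpan ℝ A) :=
    fun i => (LinearMap.proj i : (Fin n → ℝ) →ₗ[ℝ] ℝ) ∘ₗ (vectorSpan ℝ A).subtype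
  obtain ⟨κ, a, ha, hspan, hli⟩ := exists_linearIndependent' ℝ φ
  have : Finite κ := Finite.of_injective a ha
  have := Fintype.ofFinite κ
  have hκ : Fintype.card κ ≤ Module.finrank ℝ (vectorSpan ℝ A) := by
    rw [← Subspace.dual_finrank_eq]
    exact hli.fintype_card_le_finrank
  have hinj : Function.Injective
      (fun (x : A) (j : κ) => (decide (x.1 (a j) = 0) : Bool)) := by
    intro x y h
    have hj : ∀ j, x.1 (a j) = y.1 (a j) := by
      intro j
      have h' := congrFun h j
      simp only [decide_eq_decide] at h'
      rcases hA x.2 (a j) with hx | hx <;> rcases hA y.2 (a j) with hy | hy <;> simp_all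
    have hmem : x.1 - y.1 ∈ vectorSpan ℝ A := vsub_mem_vectorSpan ℝ x.2 y.2
    have hker : ∀ ψ ∈ Submodule.span ℝ (Set.range φ), ψ ⟨x.1 - y.1, hmem⟩ = 0 := by
      rw [← hspan]
      intro ψ hψ
      induction hψ using Submodule.span_induction with
      | mem ψ h =>
        obtain ⟨j, rfl⟩ := h
        exact sub_eq_zero.2 (hj j)
      | zero => rfl
      | add ψ ψ' _ _ h h' => rw [LinearMap.add_apply, h, h', add_zero]
      | smul c ψ _ h => rw [LinearMap.smul_apply, h, smul_zero]
    apply Subtype.ext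
    funext i
    exact sub_eq_zero.1 (hker (φ i) (Submodule.subset_span ⟨i, rfl⟩))
  calc A.ncard = Nat.card A := (Nat.card_coe_set_eq A).symm
    _ ≤ Nat.card (κ → Bool) := Nat.card_le_card_of_injective _ hinj
    _ = 2 ^ Fintype.card κ := by simp
    _ ≤ _ := Nat.pow_le_pow_right two_pos hκ

theorem exists_affineMap_eq_smul {n : ℕ} (w : cubeSymm n) :
    ∃ f : (Fin n → ℝ) →ᵃ[ℝ] (Fin n → ℝ), ∀ x, f x = w • x := by
  obtain ⟨w, π, ε, h⟩ := w
  refine ⟨(LinearMap.pi fun i => (if ε i then (-1 : ℝ) else 1) •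
    (LinearMap.proj (π i) : (Fin n → ℝ) →ₗ[ℝ] ℝ)).toAffineMap +
    AffineMap.const ℝ _ (fun i => if ε i then (1 : ℝ) else 0), fun x => ?_⟩
  funext i
  change _ = w x i
  rw [h]
  cases hi : ε i <;> simp [hi, sub_eq_neg_add]

theorem smul_convexHull {n : ℕ} (w : cubeSymm n) (T : Set (Fin n → ℝ)) :
    w • convexHull ℝ T = convexHull ℝ (w • T) := by
  obtain ⟨f, hf⟩ := exists_affineMap_eq_smul w
  have hf' : ∀ U : Set (Fin n → ℝ), w • U = f '' U := fun U => by
    ext; simp [Set.mem_smul_set, hf]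
  rw [hf', hf', f.image_convexHull]

theorem exists_affineSubspace_coe_eq_smul {n : ℕ} (w : cubeSymm n)
    (Q : AffineSubspace ℝ (Fin n → ℝ)) :
    ∃ Q' : AffineSubspace ℝ (Fin n → ℝ), (Q' : Set (Fin n → ℝ)) = w • (Q : Set (Fin n → ℝ)) ∧
      Module.finrank ℝ Q'.direction ≤ Module.finrank ℝ Q.direction := by
  obtain ⟨f, hf⟩ := exists_affineMap_eq_smul w
  refine ⟨Q.map f, ?_, ?_⟩
  · ext
    simp [Set.mem_smul_set, hf]
  · rw [AffineSubspace.map_direction]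
    exact Submodule.finrank_map_le _ _

theorem affineSpan_smul {n : ℕ} (w : cubeSymm n) (T : Set (Fin n → ℝ)) :
    (affineSpan ℝ (w • T) : Set (Fin n → ℝ)) = w • (affineSpan ℝ T : Set (Fin n → ℝ)) := by
  obtain ⟨f, hf⟩ := exists_affineMap_eq_smul w
  have hf' : ∀ U : Set (Fin n → ℝ), w • U = f '' U := fun U => by
    ext; simp [Set.mem_smul_set, hf]
  rw [hf', hf', ← AffineSubspace.map_span, AffineSubspace.coe_map]

theorem smul_subset_cubeVertices {n : ℕ} (w : cubeSymm n) {A : Set (Fin n → ℝ)}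
    (hA : A ⊆ cubeVertices n) : w • A ⊆ cubeVertices n := by
  rintro _ ⟨x, hx, rfl⟩
  exact smul_mem_cubeVertices w (hA hx)

theorem finite_cubeVertices (n : ℕ) : (cubeVertices n).Finite := by
  have h : Finite (verticesIn (Set.univ : Set (Fin n → ℝ))) := inferInstance
  rw [verticesIn, Set.inter_univ] at h
  exact Set.toFinite _

theorem ncard_smul {n : ℕ} (w : cubeSymm n) (A : Set (Fin n → ℝ)) : (w • A).ncard = A.ncard :=
  Set.ncard_image_of_injective A (MulAction.injective w)

theorem extremePoints_convexHull_eq {n : ℕ} {T : Set (Fin n → ℝ)} (hT : T ⊆ cubeVertices n) :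
    (convexHull ℝ T).extremePoints ℝ = T := by
  refine subset_antisymm extremePoints_convexHull_subset fun x hx => ?_
  -- A point extreme in the solid cube stays extreme in any subset containing it.
  have hcube : (Set.univ.pi fun _ : Fin n => Set.Icc (0 : ℝ) 1).extremePoints ℝ =
      cubeVertices n := by
    rw [extremePoints_pi]
    ext y
    simp [cubeVertices, Set.mem_pi]
  refine inter_extremePoints_subset_extremePoints_of_subset
    (A := Set.univ.pi fun _ : Fin n => Set.Icc (0 : ℝ) 1) ?_ ⟨subset_convexHull ℝ T hx, ?_⟩
  · refine convexHull_min (fun y hy => ?_) (convex_pi fun _ _ => convex_Icc _ _)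
    exact extremePoints_subset (hcube ▸ hT hy)
  · exact hcube ▸ hT hx

/-- The sets of `k` vertices of the cube lying in `S`. -/
def vertexSets {n : ℕ} (S : Set (Fin n → ℝ)) (k : ℕ) : Set (Set (Fin n → ℝ)) :=
  {A | A ⊆ verticesIn S ∧ A.ncard = k}

theorem finite_vertexSets {n : ℕ} (S : Set (Fin n → ℝ)) (k : ℕ) : (vertexSets S k).Finite :=
  (finite_cubeVertices n).finite_subsets.subset fun _ hA => hA.1.trans Set.inter_subset_left

/-- Taking hulls and taking extreme points are mutually inverse and commute with symmetries;
convexity of `S` keeps the hulls inside `S`. -/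
theorem numPartialClasses_eq {n : ℕ} {S : Set (Fin n → ℝ)} (hS : Convex ℝ S) (k : ℕ) :
    numPartialClasses S k =
      numClasses (MulAction.orbitRel (cubeSymm n) (Set (Fin n → ℝ))) (vertexSets S k) := by
  have hrange : Set.range (Subtype.val : PolytopesIn S k → Set (Fin n → ℝ)) =
      (fun A => convexHull ℝ A) '' vertexSets S k := by
    ext P
    constructor
    · rintro ⟨⟨P, ⟨T, hT, rfl⟩, hPS, hk⟩, rfl⟩
      rw [extremePoints_convexHull_eq hT] at hk
      exact ⟨T, ⟨fun x hx => ⟨hT hx, hPS (subset_convexHull ℝ T hx)⟩, hk⟩, rfl⟩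
    · rintro ⟨A, ⟨hA, hk⟩, rfl⟩
      have hA' : A ⊆ cubeVertices n := hA.trans Set.inter_subset_left
      exact ⟨⟨convexHull ℝ A, ⟨A, hA', rfl⟩,
        convexHull_min (hA.trans Set.inter_subset_right) hS,
        by rwa [extremePoints_convexHull_eq hA']⟩, rfl⟩
  rw [numPartialClasses, partialEquivalence, card_quotient_comap]
  refine (congrArg _ hrange).trans ?_
  refine numClasses_image _ _ _ _ fun A hA B hB => ?_
  have hA' : A ⊆ cubeVertices n := hA.1.trans Set.inter_subset_left
  have hB' : B ⊆ cubeVertices n := hB.1.trans Set.inter_subset_left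
  simp only [MulAction.orbitRel_apply, MulAction.mem_orbit_iff]
  refine exists_congr fun g => ?_
  rw [smul_convexHull]
  refine ⟨fun h => by rw [h], fun h => ?_⟩
  rw [← extremePoints_convexHull_eq (smul_subset_cubeVertices g hB'), h,
    extremePoints_convexHull_eq hA']

theorem polyaCoeff_eq {n : ℕ} (S : Set (Fin n → ℝ)) (G : Subgroup (cubeSymm n))
    (hG : G ≤ MulAction.stabilizer (cubeSymm n) S) (k : ℕ) :
    polyaCoeff S G hG k =
      numClasses (MulAction.orbitRel G (Set (Fin n → ℝ))) (vertexSets S k) := by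
  classical
  let _ := verticesAction S G hG
  have h := coeff_cycleIndex (G := G) (X := verticesIn S) k
  rw [Nat.card_coe_set_eq] at h
  rw [polyaCoeff, polyaPolynomial, h]
  congr 1
  let f : Set.powersetCard (verticesIn S) k → Set (Fin n → ℝ) :=
    fun s => Subtype.val '' ((s : Finset (verticesIn S)) : Set (verticesIn S))
  have hf : Function.Injective f := fun s t hst =>
    Subtype.ext (Finset.coe_injective (Set.image_injective.2 Subtype.val_injective hst))
  have hsmul : ∀ (g : G) s, f (g • s) = g • f s := by
    intro g s
    ext x
    simp only [f, Set.powersetCard.coe_smul, Finset.coe_smul_finset, Set.mem_image,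
      Set.mem_smul_set]
    constructor
    · rintro ⟨_, ⟨y, hy, rfl⟩, rfl⟩
      exact ⟨y, ⟨y, hy, rfl⟩, rfl⟩
    · rintro ⟨_, ⟨y, hy, rfl⟩, rfl⟩
      exact ⟨g • y, ⟨y, hy, rfl⟩, rfl⟩
  have hrange : Set.range f = vertexSets S k := by
    ext A
    constructor
    · rintro ⟨s, rfl⟩
      refine ⟨?_, ?_⟩
      · rintro _ ⟨x, _, rfl⟩
        exact x.2
      · rw [Set.ncard_image_of_injective _ Subtype.val_injective, Set.ncard_coe_finset]
        exact s.2
    · rintro ⟨hA, hk⟩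
      have := Fintype.ofFinite (verticesIn S)
      have hval : Subtype.val '' (Subtype.val ⁻¹' A : Set (verticesIn S)) = A :=
        Set.image_preimage_eq_of_subset (by rwa [Subtype.range_coe])
      refine ⟨⟨(Subtype.val ⁻¹' A : Set (verticesIn S)).toFinset, ?_⟩, ?_⟩
      · rw [Set.powersetCard.mem_iff, ← Set.ncard_eq_toFinset_card',
          ← Set.ncard_image_of_injective _ Subtype.val_injective, hval, hk]
      · simp only [f, Set.coe_toFinset]
        exact hval
  rw [← hrange, ← card_quotient_comap]
  congr 2
  ext s t
  change MulAction.orbitRel G _ s t ↔ MulAction.orbitRel G _ (f s) (f t)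
  simp only [MulAction.orbitRel_apply, MulAction.mem_orbit_iff]
  refine exists_congr fun g => ?_
  rw [← hsmul, hf.eq_iff]

theorem IsSpannedHyperplane.exists_affineSubspace {n : ℕ} {H : Set (Fin n → ℝ)}
    (hH : IsSpannedHyperplane H) : ∃ Q : AffineSubspace ℝ (Fin n → ℝ),
      (Q : Set (Fin n → ℝ)) = H ∧ Module.finrank ℝ Q.direction ≤ n - 1 := by
  obtain ⟨v, -, hv, rfl⟩ := hH
  refine ⟨_, rfl, ?_⟩
  rw [direction_affineSpan]
  rcases n with - | n
  · simp
  · rw [hv.finrank_vectorSpan (Fintype.card_fin _), Nat.add_sub_cancel]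

theorem affineSpan_eq_interSymm {n : ℕ} {H : Set (Fin n → ℝ)} (hH : IsSpannedHyperplane H)
    {A : Set (Fin n → ℝ)} (hA : A ⊆ cubeVertices n) (hAk : (2 : ℝ) ^ ((n : ℤ) - 3) < A.ncard)
    (w : cubeSymm n) (hw : H ≠ w • H) (hAw : A ⊆ interSymm H w) :
    (affineSpan ℝ A : Set (Fin n → ℝ)) = interSymm H w := by
  obtain ⟨Q, rfl, hQ⟩ := hH.exists_affineSubspace
  obtain ⟨Q', hQ', hfin⟩ := exists_affineSubspace_coe_eq_smul w Q
  have hne : A.Nonempty := by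
    rw [Set.nonempty_iff_ne_empty]
    rintro rfl
    rw [Set.ncard_empty, Nat.cast_zero] at hAk
    exact absurd hAk (not_lt.2 (by positivity))
  have hinter : interSymm (Q : Set (Fin n → ℝ)) w = (Q ⊓ Q' : AffineSubspace ℝ (Fin n → ℝ)) := by
    rw [interSymm, ← hQ']
    rfl
  rw [hinter] at hAw ⊢
  rw [← hQ'] at hw
  have hle : affineSpan ℝ A ≤ Q ⊓ Q' := affineSpan_le.2 hAw
  have hQne : ((Q ⊓ Q' : AffineSubspace ℝ (Fin n → ℝ)) : Set (Fin n → ℝ)).Nonempty :=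
    hne.mono hAw
  have heq : ∀ {P P' : AffineSubspace ℝ (Fin n → ℝ)}, (P : Set (Fin n → ℝ)).Nonempty → P ≤ P' →
      Module.finrank ℝ P'.direction ≤ Module.finrank ℝ P.direction → P = P' :=
    fun hP hPP' h => AffineSubspace.eq_of_direction_eq_of_nonempty_of_le
      (Submodule.eq_of_le_of_finrank_le (AffineSubspace.direction_le hPP') h) hP hPP'
  -- Equal dimensions would give `Q ≤ Q'`, hence `Q = Q'`, as a symmetry does not raise dimension.
  have hlt : Module.finrank ℝ (Q ⊓ Q').direction < Module.finrank ℝ Q.direction := by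
    by_contra! h
    have h1 : Q ⊓ Q' = Q := heq hQne inf_le_left h
    have h2 : Q ≤ Q' := inf_eq_left.1 h1
    exact hw (congrArg _ (heq (h1 ▸ hQne) h2 hfin))
  have hdim : (n : ℤ) - 3 < Module.finrank ℝ (vectorSpan ℝ A) := by
    rw [← zpow_lt_zpow_iff_right₀ (one_lt_two : (1 : ℝ) < 2)]
    refine hAk.trans_le ?_
    rw [zpow_natCast]
    exact_mod_cast ncard_le_two_pow_finrank hA
  rw [heq ((affineSpan_nonempty ℝ).2 hne) hle]
  rw [direction_affineSpan]
  omega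

end Cube

/-! ### Assembly of the formula. -/

theorem mem_intersections_of_subset {n k : ℕ} {H : Set (Fin n → ℝ)} {A : Set (Fin n → ℝ)}
    (hA : A ⊆ cubeVertices n) (hAk : A.ncard = k) {w : cubeSymm n} (hw : H ≠ w • H)
    (hAw : A ⊆ interSymm H w) : interSymm H w ∈ intersections H k :=
  ⟨w, hw, hAk ▸ Set.ncard_le_ncard (fun _ hx => ⟨hA hx, hAw hx⟩) (Set.toFinite _), rfl⟩

theorem theorem8p4 (n k : ℕ) (hk₁ : (2 : ℝ) ^ ((n : ℤ) - 3) < k)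
    (hk₂ : (k : ℝ) ≤ (2 : ℝ) ^ ((n : ℤ) - 2))
    (H : Set (Fin n → ℝ)) (hH : IsSpannedHyperplane H) (hkH : k ≤ (verticesIn H).ncard)
    (R₁ R₂ : Finset (cubeSymm n))
    (hR₁ : IsRepresentatives H k (stab H) R₁)
    (hR₂ : IsRepresentatives H k ⊤ R₂) :
    (numPartialClasses H k : ℚ) =
      polyaCoeff H (stab H) le_rfl k
        - ∑ w ∈ R₁, polyaCoeff (interSymm H w) (stabInter H w) inf_le_right k
        + ∑ w ∈ R₂, polyaCoeff (interSymm H w) (stab (interSymm H w)) le_rfl k := by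
  have hpow : ∀ A : Set (Fin n → ℝ), A.ncard = k → (2 : ℝ) ^ ((n : ℤ) - 3) < A.ncard := by
    rintro A rfl
    exact hk₁
  let sp : Set (Fin n → ℝ) → Set (Fin n → ℝ) := fun A => affineSpan ℝ A
  -- All of the cube is allowed, not only `H`, because the fibre count needs a family invariant
  -- under `B_n`.
  let W : Set (Set (Fin n → ℝ)) := {A | A ⊆ cubeVertices n ∧ A.ncard = k}
  have hspan : ∀ A ∈ W, ∀ w : cubeSymm n, H ≠ w • H → A ⊆ interSymm H w →
      sp A = interSymm H w := fun A hA w hw hAw =>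
    affineSpan_eq_interSymm hH hA.1 (hpow A hA.2) w hw hAw
  have hspanE : ∀ A ∈ W, ∀ w : cubeSymm n, H ≠ w • H → A ⊆ interSymm H w →
      sp A ∈ intersections H k := fun A hA w hw hAw =>
    hspan A hA w hw hAw ▸ mem_intersections_of_subset hA.1 hA.2 hw hAw
  have hWfin : W.Finite := (finite_cubeVertices n).finite_subsets.subset fun _ hA => hA.1
  have hWsmul : ∀ (g : cubeSymm n), ∀ A ∈ W, g • A ∈ W := fun g A hA =>
    ⟨smul_subset_cubeVertices g hA.1, by rw [ncard_smul, hA.2]⟩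
  have hspsmul : ∀ (g : cubeSymm n) A, sp (g • A) = g • sp A := fun g A => affineSpan_smul g A
  have hfiber : ∀ w : cubeSymm n, interSymm H w ∈ intersections H k →
      {A | A ∈ W ∧ sp A = interSymm H w} = vertexSets (interSymm H w) k := by
    rintro w ⟨w', hw', -, h⟩
    ext A
    constructor
    · rintro ⟨hA, hsp⟩
      exact ⟨fun x hx => ⟨hA.1 hx, hsp ▸ subset_affineSpan ℝ A hx⟩, hA.2⟩
    · rintro ⟨hA, hAk⟩
      have hAW : A ∈ W := ⟨hA.trans Set.inter_subset_left, hAk⟩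
      refine ⟨hAW, ?_⟩
      rw [h]
      exact hspan A hAW w' hw' (h ▸ hA.trans Set.inter_subset_right)
  let Y₂ : Set (Set (Fin n → ℝ)) := {A | A ∈ W ∧ sp A ∈ intersections H k}
  let Y₁ : Set (Set (Fin n → ℝ)) := vertexSets H k \ Y₂
  have hW_of_mem : ∀ A ∈ vertexSets H k, A ∈ W := fun A hA =>
    ⟨hA.1.trans Set.inter_subset_left, hA.2⟩
  have hY₂ : Y₂ ⊆ vertexSets H k := by
    rintro A ⟨hA, w, -, -, h⟩
    refine ⟨fun x hx => ⟨hA.1 hx, ?_⟩, hA.2⟩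
    have hx' : x ∈ sp A := subset_affineSpan ℝ A hx
    rw [h] at hx'
    exact hx'.1
  have hunion : vertexSets H k = Y₁ ∪ Y₂ := (Set.sdiff_union_of_subset hY₂).symm
  have hY₁fin : Y₁.Finite := (finite_vertexSets H k).subset Set.sdiff_subset
  have hY₂fin : Y₂.Finite := (finite_vertexSets H k).subset hY₂
  have hmove : ∀ (g : cubeSymm n), ∀ A ∈ vertexSets H k, g • A ∈ vertexSets H k → H ≠ g • H →
      g • A ∈ Y₂ := by
    intro g A hA hgA hg
    have hgAW := hW_of_mem _ hgA
    refine ⟨hgAW, hspanE _ hgAW g hg fun x hx => ⟨(hgA.1 hx).2, ?_⟩⟩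
    exact Set.smul_set_mono (hA.1.trans Set.inter_subset_right) hx
  have hclosed : ∀ (g : cubeSymm n), ∀ A ∈ Y₂, g • A ∈ vertexSets H k → g • A ∈ Y₂ := by
    rintro g A hA hgA
    -- If `g` fixes `H`, it carries `H ∩ w(H)` to `H ∩ gw(H)`, with `gw(H) ≠ H`; otherwise the image
    -- lies in `H ∩ g(H)`.
    by_cases hg : H = g • H
    · obtain ⟨w, hw, -, h⟩ := hA.2
      refine ⟨hWsmul g A hA.1, hspanE _ (hWsmul g A hA.1) (g * w) ?_ ?_⟩
      · intro hgw
        rw [mul_smul] at hgw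
        exact hw (MulAction.injective g (hg.symm.trans hgw))
      · have hle : g • A ⊆ g • interSymm H w :=
          Set.smul_set_mono (h ▸ subset_affineSpan ℝ A)
        rwa [interSymm, Set.smul_set_inter, ← hg, ← mul_smul] at hle
    · exact hmove g A (hY₂ hA) hgA hg
  have hcross : ∀ G : Subgroup (cubeSymm n), ∀ A ∈ Y₁, ∀ B ∈ Y₂,
      ¬ MulAction.orbitRel G (Set (Fin n → ℝ)) A B := by
    intro G A hA B hB h
    obtain ⟨g, -, rfl⟩ := (orbitRel_subgroup_iff _ _ _).1 h
    exact hA.2 (hclosed g B hB hA.1)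
  have hsplit : ∀ G : Subgroup (cubeSymm n),
      numClasses (MulAction.orbitRel G (Set (Fin n → ℝ))) (vertexSets H k) =
        numClasses (MulAction.orbitRel G (Set (Fin n → ℝ))) Y₁ +
          numClasses (MulAction.orbitRel G (Set (Fin n → ℝ))) Y₂ := fun G => by
    rw [hunion]
    exact numClasses_union _ hY₁fin hY₂fin (hcross G)
  have hY₁ : numClasses (MulAction.orbitRel (⊤ : Subgroup (cubeSymm n)) (Set (Fin n → ℝ))) Y₁ =
      numClasses (MulAction.orbitRel (stab H) (Set (Fin n → ℝ))) Y₁ := by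
    refine numClasses_congr _ _ _ fun A hA B hB => ?_
    rw [orbitRel_subgroup_iff, orbitRel_subgroup_iff]
    constructor
    · rintro ⟨g, -, h⟩
      exact ⟨g, Subgroup.mem_top g, h⟩
    · rintro ⟨g, -, rfl⟩
      refine ⟨g, MulAction.mem_stabilizer_iff.2 ?_, rfl⟩
      by_contra hg
      exact hA.2 (hmove g B hB.1 hA.1 (Ne.symm hg))
  have htop : numClasses (MulAction.orbitRel (cubeSymm n) (Set (Fin n → ℝ))) (vertexSets H k) =
      numClasses (MulAction.orbitRel (⊤ : Subgroup (cubeSymm n)) (Set (Fin n → ℝ)))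
        (vertexSets H k) := by
    refine numClasses_congr _ _ _ fun A _ B _ => ?_
    rw [orbitRel_subgroup_iff, MulAction.orbitRel_apply, MulAction.mem_orbit_iff]
    simp
  have hsum₁ : numClasses (MulAction.orbitRel (stab H) (Set (Fin n → ℝ))) Y₂ =
      ∑ w ∈ R₁, numClasses (MulAction.orbitRel (stabInter H w) (Set (Fin n → ℝ)))
        (vertexSets (interSymm H w) k) := by
    rw [numClasses_eq_sum_fibers (stab H) (fun w => stabInter H w) hWfin
      (fun g _ => hWsmul g) sp hspsmul _ R₁ (interSymm H)
      (fun w g => by rw [Subgroup.mem_inf, MulAction.mem_stabilizer_iff (a := interSymm H w)])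
      hR₁.1 hR₁.2]
    exact Finset.sum_congr rfl fun w hw => by rw [hfiber w (hR₁.1 w hw)]
  have hsum₂ : numClasses (MulAction.orbitRel (⊤ : Subgroup (cubeSymm n)) (Set (Fin n → ℝ))) Y₂ =
      ∑ w ∈ R₂, numClasses (MulAction.orbitRel (stab (interSymm H w)) (Set (Fin n → ℝ)))
        (vertexSets (interSymm H w) k) := by
    rw [numClasses_eq_sum_fibers ⊤ (fun w => stab (interSymm H w)) hWfin
      (fun g _ => hWsmul g) sp hspsmul _ R₂ (interSymm H)
      (fun w g => by simp [MulAction.mem_stabilizer_iff]) hR₂.1 hR₂.2]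
    exact Finset.sum_congr rfl fun w hw => by rw [hfiber w (hR₂.1 w hw)]
  have hconv : Convex ℝ H := by
    obtain ⟨Q, rfl, -⟩ := hH.exists_affineSubspace
    exact Q.convex
  simp only [polyaCoeff_eq]
  rw [numPartialClasses_eq hconv, htop, hsplit, hsplit, hY₁, hsum₁, hsum₂]
  push_cast
  ring
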